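/- Let $\Gamma$ be a finite graph without loops or multiple edges, with vertex set $V$ and vertex (adjacency) matrix $\epsilon=(\epsilon_{ij})$. A path of length $\alpha$ in $\Gamma$ is a tuple $(i_1,\dots,i_{\alpha+1})$ of vertices in which any two consecutive vertices are joined by an edge (vertices may be repeated). Let $k\in\mathbb{N}$, and let $C(\mathbb{G}_k^+(\Gamma))$ be the universal unital $C^*$-algebra generated by self-adjoint elements $q_{ij}$ ($i,j\in V$) subject to the relations $$\sum_{j}q_{ij}=1=\sum_j q_{ji},\qquad q_{ij}q_{il}=\delta_{jl}\,q_{ij},\qquad q_{ji}q_{li}=\delta_{jl}\,q_{ji},\qquad q\epsilon=\epsilon q,$$ where $q=(q_{ij})$, together with $$q_{i_1j_1}q_{i_2j_2}\cdots q_{i_\beta j_\beta}=q_{i_\beta j_\beta}\cdots q_{i_2j_2}q_{i_1j_1}$$ for all $\beta\le k+1$ and all paths $(i_1,\dots,i_\beta)$ and $(j_1,\dots,j_\beta)$. Two paths $(i_1,\dots,i_\gamma)$ and $(j_1,\dots,j_\gamma)$ with the same number of vertices are called $k$-equivalent, written $(i_1,\dots,i_\gamma)\sim^k(j_1,\dots,j_\gamma)$,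 if $$q_{i_1j_1}\cdots q_{i_\gamma j_\gamma}\neq 0\quad\text{in } C(\mathbb{G}_k^+(\Gamma));$$ paths of different lengths are not $k$-equivalent. **Lemma.** $\sim^k$ is an equivalence relation on the set of paths of length at most $2k+1$ (that is, with at most $2k+2$ vertices). -/

import Mathlib

open scoped ENNReal

noncomputable section

namespace QuantumPath

variable {V : Type*}

/-- A path in a graph: a nonempty list of vertices `(i₁, …, i_γ)` in which consecutive vertices
are joined by an edge (vertices may be repeated). -/
structure GraphPath (Γ : SimpleGraph V) where
  verts : List V
  ne_nil : verts ≠ []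
  chain : verts.IsChain Γ.Adj

/-- The length of a path is its number of edges; a path of length `α` has `α + 1` vertices. -/
def GraphPath.length {Γ : SimpleGraph V} (p : GraphPath Γ) : ℕ :=
  p.verts.length - 1

/-- The list `[q i₁ j₁, …, q i_γ j_γ]` attached to two tuples of vertices of the same size. -/
def factors {B : Type*} (q : V → V → B) (i j : List V) : List B :=
  List.zipWith q i j

/-- The product `q i₁ j₁ * ⋯ * q i_γ j_γ`, in this order. -/
def pathProd {B : Type*} [Monoid B] (q : V → V → B) (i j : List V) : B :=
  (factors q i j).prod

open Classical in
/-- The vertex matrix `ε`, with entries `1` at adjacent pairs of vertices and `0` elsewhere. -/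
def vertexMatrix (Γ : SimpleGraph V) (B : Type*) [Ring B] : Matrix V V B :=
  Matrix.of fun i j => if Γ.Adj i j then 1 else 0

variable [Fintype V]

/-- The defining relations of `C(Aut⁺(Γ))` in Banica's sense: `q` is a magic unitary, that is, its
entries are self-adjoint, each row and each column sums to one and consists of mutually orthogonal
idempotents, and `q` commutes with the vertex matrix. -/
structure AutRelations (Γ : SimpleGraph V) {B : Type*} [Ring B] [StarRing B]
    (q : V → V → B) : Prop where
  selfAdjoint : ∀ i j, star (q i j) = q i j
  row_sum : ∀ i, ∑ j, q i j = 1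
  col_sum : ∀ i, ∑ j, q j i = 1
  idem : ∀ i j, q i j * q i j = q i j
  row_orth : ∀ i j l, j ≠ l → q i j * q i l = 0
  col_orth : ∀ i j l, j ≠ l → q j i * q l i = 0
  comm_vertexMatrix : Matrix.of q * vertexMatrix Γ B = vertexMatrix Γ B * Matrix.of q

/-- The defining relations of `C(𝔾ₖ⁺(Γ))`: those of `C(Aut⁺(Γ))` together with
`q i₁ j₁ ⋯ q i_β j_β = q i_β j_β ⋯ q i₁ j₁` for all paths `(i₁, …, i_β)` and `(j₁, …, j_β)` with
`β ≤ k + 1` vertices. -/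
structure GkRelations (Γ : SimpleGraph V) (k : ℕ) {B : Type*} [Ring B] [StarRing B]
    (q : V → V → B) : Prop extends AutRelations Γ q where
  path_reverse : ∀ i j : GraphPath Γ, i.verts.length = j.verts.length →
    i.verts.length ≤ k + 1 →
    (factors q i.verts j.verts).prod = (factors q i.verts j.verts).reverse.prod

/-- A representation of the generators and relations of `C(𝔾ₖ⁺(Γ))` by bounded operators on a
(nonzero) Hilbert space. -/
structure HilbertRep (Γ : SimpleGraph V) (k : ℕ) where
  H : Type
  [normedGroup : NormedAddCommGroup H]
  [innerSpace : InnerProductSpace ℂ H]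
  [complete : CompleteSpace H]
  [nontriv : Nontrivial H]
  op : V → V → (H →L[ℂ] H)
  rel : GkRelations Γ k op

attribute [instance] HilbertRep.normedGroup HilbertRep.innerSpace HilbertRep.complete
  HilbertRep.nontriv

/-- The bounded operators on the Hilbert space of a representation. -/
abbrev HilbertRep.Ops {Γ : SimpleGraph V} {k : ℕ} (π : HilbertRep Γ k) : Type :=
  π.H →L[ℂ] π.H

/-- The C⋆-algebra of all bounded families `(T_π)`, `T_π` a bounded operator on the space of `π`,
where `π` runs over all representations of the relations; the norm is the supremum norm. -/
abbrev BoundedFamilies (Γ : SimpleGraph V) (k : ℕ) :=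
  lp (fun π : HilbertRep Γ k => π.Ops) ∞

instance (Γ : SimpleGraph V) (k : ℕ) : CStarAlgebra (BoundedFamilies Γ k) where

theorem norm_op_le_one {Γ : SimpleGraph V} {k : ℕ} (π : HilbertRep Γ k) (i j : V) :
    ‖π.op i j‖ ≤ 1 := by
  have h1 := CStarRing.norm_star_mul_self (x := π.op i j)
  rw [π.rel.selfAdjoint, π.rel.idem] at h1
  nlinarith [norm_nonneg (π.op i j)]

/-- The image `(π(q i j))_π` of the generator `q i j` under the direct sum of all
representations. -/
def universalGen (Γ : SimpleGraph V) (k : ℕ) (i j : V) : BoundedFamilies Γ k :=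
  ⟨fun π => π.op i j, memℓp_infty ⟨1, by rintro _ ⟨π, rfl⟩; exact norm_op_le_one π i j⟩⟩

/-- The C⋆-algebra `C(𝔾ₖ⁺(Γ))`: the universal C⋆-algebra generated by `q i j`, `i, j ∈ V`, subject
to `GkRelations`. It is the completion of the ⋆-algebra of polynomials in the `q i j` in the
(semi)norm `sup_π ‖π(x)‖`, over all representations `π` of the relations, that is, the norm closure
of the ⋆-algebra generated by the families `(π(q i j))_π`. -/
def CGk (Γ : SimpleGraph V) (k : ℕ) : StarSubalgebra ℂ (BoundedFamilies Γ k) :=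
  (StarAlgebra.adjoin ℂ {x | ∃ i j, universalGen Γ k i j = x}).topologicalClosure

instance (Γ : SimpleGraph V) (k : ℕ) : CStarAlgebra (CGk Γ k) :=
  StarSubalgebra.cstarAlgebra _ (h_closed := StarSubalgebra.isClosed_topologicalClosure _)

/-- The generators `q i j` of `C(𝔾ₖ⁺(Γ))`. -/
def q (Γ : SimpleGraph V) (k : ℕ) (i j : V) : CGk Γ k :=
  ⟨universalGen Γ k i j, StarSubalgebra.le_topologicalClosure _
    (StarAlgebra.subset_adjoin ℂ _ ⟨i, j, rfl⟩)⟩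

/-- `k`-equivalence of paths `(i₁, …, i_γ) ∼ᵏ (j₁, …, j_γ)`: they have the same number of vertices
and `q i₁ j₁ ⋯ q i_γ j_γ ≠ 0` in `C(𝔾ₖ⁺(Γ))`. -/
def KEquiv (Γ : SimpleGraph V) (k : ℕ) (i j : GraphPath Γ) : Prop :=
  i.length = j.length ∧ pathProd (q Γ k) i.verts j.verts ≠ 0

/-- The evaluation of `C(𝔾ₖ⁺(Γ))` at a representation of the relations. -/
def evalRep {Γ : SimpleGraph V} {k : ℕ} (π : HilbertRep Γ k) : CGk Γ k →⋆ₐ[ℂ] π.Ops where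
  toFun x := (x : BoundedFamilies Γ k) π
  map_one' := rfl
  map_mul' _ _ := rfl
  map_zero' := rfl
  map_add' _ _ := rfl
  commutes' _ := rfl
  map_star' _ := rfl

@[simp]
theorem evalRep_q {Γ : SimpleGraph V} {k : ℕ} (π : HilbertRep Γ k) (i j : V) :
    evalRep π (q Γ k i j) = π.op i j := rfl

theorem evalRep_ext {Γ : SimpleGraph V} {k : ℕ} {x y : CGk Γ k}
    (h : ∀ π : HilbertRep Γ k, evalRep π x = evalRep π y) : x = y :=
  Subtype.ext (Subtype.ext (funext h))

theorem evalRep_factors {Γ : SimpleGraph V} {k : ℕ} (π : HilbertRep Γ k) (i j : List V) :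
    (factors (q Γ k) i j).map (evalRep π) = factors π.op i j := by
  simp [factors, List.map_zipWith]

/-- The generators of `C(𝔾ₖ⁺(Γ))` satisfy the defining relations. -/
theorem q_relations (Γ : SimpleGraph V) (k : ℕ) : GkRelations Γ k (q Γ k) where
  selfAdjoint i j := evalRep_ext fun π => by simpa [map_star] using π.rel.selfAdjoint i j
  row_sum i := evalRep_ext fun π => by simpa [map_sum] using π.rel.row_sum i
  col_sum i := evalRep_ext fun π => by simpa [map_sum] using π.rel.col_sum i
  idem i j := evalRep_ext fun π => by simpa using π.rel.idem i j
  row_orth i j l h := evalRep_ext fun π => by simpa using π.rel.row_orth i j l h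
  col_orth i j l h := evalRep_ext fun π => by simpa using π.rel.col_orth i j l h
  comm_vertexMatrix := by
    ext1 i j
    refine evalRep_ext fun π => ?_
    have := congrFun (congrFun π.rel.comm_vertexMatrix i) j
    simpa [Matrix.mul_apply, vertexMatrix, map_sum, apply_ite (evalRep π)] using this
  path_reverse i j h hk := evalRep_ext fun π => by
    rw [map_list_prod, map_list_prod, List.map_reverse, evalRep_factors]
    exact π.rel.path_reverse i j h hk

/-- The universal property: a family of bounded operators satisfying the relations is the image of
the generators under exactly one unital ⋆-homomorphism. -/
theorem existsUnique_lift {Γ : SimpleGraph V} {k : ℕ} (π : HilbertRep Γ k) :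
    ∃! φ : CGk Γ k →⋆ₐ[ℂ] π.Ops, ∀ i j, φ (q Γ k i j) = π.op i j := by
  refine ⟨evalRep π, fun i j => rfl, fun φ hφ => ?_⟩
  have key : φ = evalRep π := by
    have hc : ContinuousLinearMapClass (CGk Γ k →⋆ₐ[ℂ] π.Ops) ℂ (CGk Γ k) π.Ops :=
      NonUnitalStarAlgHom.instContinuousLinearMapClassComplex
    have h1 : Continuous φ := map_continuous φ
    have h2 : Continuous (evalRep π) := map_continuous (evalRep π)
    refine StarAlgHom.ext_topologicalClosure h1 h2 ?_
    refine StarAlgHom.ext_adjoin ?_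
    rintro ⟨x, hx⟩ ⟨i, j, rfl⟩
    exact hφ i j
  exact key

end QuantumPath

end

open scoped TensorProduct

namespace QuantumPath

variable {V : Type*} {Γ : SimpleGraph V} {k : ℕ}

/-! ### Products along pairs of tuples -/

section Factors

variable {B C : Type*}

/-! The three properties come from the quantum group structure, read off in Hilbert space
representations of the relations: a product of generators is nonzero iff some representation does
not kill it (`pathProd_q_ne_zero_iff`). Reflexivity is the counit `q i j ↦ δ i j`. Symmetry holds
because the transposed matrix satisfies the same relations.

Transitivity uses the comultiplication `q i l ↦ ∑ j, q i j ⊗ q j l`, realised as a tensor product of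
representations (`GkRelations.comp`, `HilbertRep.tensor`). Write `a`, `b` for the two commuting
copies of the generators and `c i l = ∑ j, a i j * b j l`. Along paths with at most `k + 1` vertices
the reversal relations make the first factor of an `a`-product commute with the rest, so each factor
can be moved next to the matching entry of `c`, where orthogonality leaves one summand. Hence the
`a`-product over `(i, j)` turns the `c`-product over `(i, l)` into the `b`-product over `(j, l)`,
from either side. Cutting a path with `2k + 2` vertices into two halves, one treated from the left
and one from the right, shows that if the `c`-product over `(i, l)` vanishes, so does the
`a`-product over `(i, j)` times the `b`-product over `(j, l)`. In the tensor product this is an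
operator `S ⊗ T` with `S, T ≠ 0`, which is not zero. -/

theorem factors_cons (q : V → V → B) (i j : V) (is js : List V) :
    factors q (i :: is) (j :: js) = q i j :: factors q is js := rfl

theorem factors_swap (q : V → V → B) (i j : List V) :
    factors (fun x y => q y x) i j = factors q j i :=
  List.zipWith_comm ..

theorem factors_map (f : B → C) (q : V → V → B) (i j : List V) :
    factors (fun x y => f (q x y)) i j = (factors q i j).map f := by
  simp [factors, List.map_zipWith]

theorem pathProd_cons [Monoid B] (q : V → V → B) (i j : V) (is js : List V) :
    pathProd q (i :: is) (j :: js) = q i j * pathProd q is js := List.prod_cons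

theorem pathProd_append [Monoid B] (q : V → V → B) (i i' : List V) {j j' : List V}
    (h : i.length = j.length) :
    pathProd q (i ++ i') (j ++ j') = pathProd q i j * pathProd q i' j' := by
  simp [pathProd, factors, List.zipWith_append h]

theorem map_pathProd {F : Type*} [Monoid B] [Monoid C] [FunLike F B C] [MonoidHomClass F B C]
    (f : F) (q : V → V → B) (i j : List V) :
    pathProd (fun x y => f (q x y)) i j = f (pathProd q i j) := by
  rw [pathProd, pathProd, factors_map, map_list_prod]

theorem commute_factors [Monoid B] {q : V → V → B} {x : B} (h : ∀ i j, Commute x (q i j))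
    {i j : List V} {y : B} (hy : y ∈ factors q i j) : Commute x y := by
  obtain ⟨m, n, rfl⟩ : ∃ m n, q m n = y := by
    induction i generalizing j with
    | nil => simp [factors] at hy
    | cons a i ih =>
      cases j with
      | nil => simp [factors] at hy
      | cons b j =>
        rw [factors_cons, List.mem_cons] at hy
        exact hy.elim (fun h => ⟨a, b, h.symm⟩) ih
  exact h m n

theorem commute_pathProd [Monoid B] {q : V → V → B} {x : B} (h : ∀ i j, Commute x (q i j))
    (i j : List V) : Commute x (pathProd q i j) :=
  Commute.list_prod_right _ _ fun _ hy => commute_factors h hy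

theorem commute_reverse_prod [Monoid B] {q : V → V → B} {x : B} (h : ∀ i j, Commute x (q i j))
    (i j : List V) : Commute x (factors q i j).reverse.prod :=
  Commute.list_prod_right _ _ fun _ hy => commute_factors h (List.mem_reverse.1 hy)

end Factors

theorem GraphPath.length_verts (p : GraphPath Γ) : p.verts.length = p.length + 1 := by
  have := List.length_pos_iff.2 p.ne_nil
  rw [GraphPath.length]
  omega

theorem commute_vertexMatrix {B : Type*} [Ring B] (i j : V) (x : B) :
    Commute x (vertexMatrix Γ B i j) := by
  by_cases h : Γ.Adj i j <;> simp [vertexMatrix, h]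

theorem vertexMatrix_symm {B : Type*} [Ring B] (i j : V) :
    vertexMatrix Γ B i j = vertexMatrix Γ B j i := by
  by_cases h : Γ.Adj i j
  · simp [vertexMatrix, h, h.symm]
  · simp [vertexMatrix, h, mt SimpleGraph.Adj.symm h]

variable [Fintype V]

/-! ### Consequences and stability of the relations -/

section Relations

variable {B C : Type*} [Ring B] [StarRing B] [Ring C] [StarRing C]

theorem comm_vertexMatrix_iff {B : Type*} [Ring B] (q : V → V → B) :
    Matrix.of q * vertexMatrix Γ B = vertexMatrix Γ B * Matrix.of q ↔
      ∀ i j, ∑ m, q i m * vertexMatrix Γ B m j = ∑ m, vertexMatrix Γ B i m * q m j := by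
  simp [← Matrix.ext_iff, Matrix.mul_apply]

/-- The relations are invariant under transposition. -/
theorem GkRelations.transpose {q : V → V → B} (h : GkRelations Γ k q) :
    GkRelations Γ k fun i j => q j i where
  selfAdjoint i j := h.selfAdjoint j i
  row_sum := h.col_sum
  col_sum := h.row_sum
  idem i j := h.idem j i
  row_orth := h.col_orth
  col_orth := h.row_orth
  comm_vertexMatrix := by
    rw [comm_vertexMatrix_iff]
    intro i j
    have := (comm_vertexMatrix_iff q).1 h.comm_vertexMatrix j i
    simpa only [(commute_vertexMatrix _ _ _).eq, vertexMatrix_symm _ i, vertexMatrix_symm j]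
      using this.symm
  path_reverse i j hij hi := by
    rw [factors_swap]
    exact h.path_reverse j i hij.symm (hij ▸ hi)

/-- The relations are preserved by ⋆-preserving ring homomorphisms. -/
theorem GkRelations.map {q : V → V → B} (h : GkRelations Γ k q) (f : B →+* C)
    (hf : ∀ x, f (star x) = star (f x)) : GkRelations Γ k fun i j => f (q i j) where
  selfAdjoint i j := by rw [← hf, h.selfAdjoint]
  row_sum i := by rw [← map_sum, h.row_sum, map_one]
  col_sum i := by rw [← map_sum, h.col_sum, map_one]
  idem i j := by rw [← map_mul, h.idem]
  row_orth i j l hjl := by rw [← map_mul, h.row_orth i j l hjl, map_zero]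
  col_orth i j l hjl := by rw [← map_mul, h.col_orth i j l hjl, map_zero]
  comm_vertexMatrix := by
    rw [comm_vertexMatrix_iff]
    intro i j
    have hv (i j : V) : vertexMatrix Γ C i j = f (vertexMatrix Γ B i j) := by
      by_cases h : Γ.Adj i j <;> simp [vertexMatrix, h]
    have := congrArg f ((comm_vertexMatrix_iff q).1 h.comm_vertexMatrix i j)
    simpa only [map_sum, map_mul, ← hv] using this
  path_reverse i j hij hi := by
    rw [factors_map, ← List.map_reverse, ← map_list_prod, ← map_list_prod,
      h.path_reverse i j hij hi]

/-- The identity matrix satisfies the relations over a commutative ring. -/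
theorem gkRelations_one [DecidableEq V] (R : Type*) [CommRing R] [StarRing R] :
    GkRelations Γ k fun i j => (1 : Matrix V V R) i j where
  selfAdjoint i j := by by_cases h : i = j <;> simp [Matrix.one_apply, h]
  row_sum i := by simp [Matrix.one_apply]
  col_sum i := by simp [Matrix.one_apply]
  idem i j := by by_cases h : i = j <;> simp [Matrix.one_apply, h]
  row_orth i j l h := by
    by_cases hij : i = j
    · subst hij; simp [h]
    · simp [Matrix.one_apply, hij]
  col_orth i j l h := by
    by_cases hij : j = i
    · subst hij; simp [h.symm]
    · simp [Matrix.one_apply, hij]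
  comm_vertexMatrix := by
    change (1 : Matrix V V R) * _ = _ * (1 : Matrix V V R)
    rw [one_mul, mul_one]
  path_reverse i j _ _ := (List.reverse_perm _).prod_eq.symm

/-- Evaluate `q i j * (qε) i j' * q i' j'` in two ways. Row orthogonality kills it, since `ε j j' =
0`; replacing `qε` by `εq`, column orthogonality leaves only `q i j * q i' j'`. -/
theorem AutRelations.mul_eq_zero {q : V → V → B} (h : AutRelations Γ q) {i i' j j' : V}
    (hi : Γ.Adj i i') (hj : ¬ Γ.Adj j j') : q i j * q i' j' = 0 := by
  classical
  have key := (comm_vertexMatrix_iff q).1 h.comm_vertexMatrix i j'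
  have h1 : q i j * (∑ m, q i m * vertexMatrix Γ B m j') * q i' j' = 0 := by
    rw [Finset.mul_sum, Finset.sum_eq_zero, zero_mul]
    intro m _
    by_cases hm : m = j
    · subst hm; simp [vertexMatrix, hj]
    · rw [← mul_assoc, h.row_orth i j m (Ne.symm hm), zero_mul]
  rw [key, mul_assoc, Finset.sum_mul, Finset.sum_eq_single i', mul_assoc, h.idem] at h1
  · simpa [vertexMatrix, hi] using h1
  · intro m _ hm
    rw [mul_assoc, h.col_orth j' m i' hm, mul_zero]
  · simp

/-- Along a path `i`, only the products over paths `j` survive. -/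
theorem AutRelations.pathProd_eq_zero {q : V → V → B} (h : AutRelations Γ q) {i j : List V}
    (hij : i.length = j.length) (hi : i.IsChain Γ.Adj) (hj : ¬ j.IsChain Γ.Adj) :
    pathProd q i j = 0 := by
  induction i generalizing j with
  | nil => cases j <;> simp_all
  | cons a i ih =>
    cases j with
    | nil => simp at hij
    | cons b j =>
      cases i with
      | nil => cases j <;> simp_all
      | cons a' i =>
        cases j with
        | nil => simp at hij
        | cons b' j =>
          rw [List.isChain_cons_cons] at hi hj
          by_cases hb : Γ.Adj b b'
          · rw [pathProd_cons, ih (by simpa using hij) hi.2 fun hc => hj ⟨hb, hc⟩, mul_zero]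
          · rw [pathProd_cons, pathProd_cons, ← mul_assoc, h.mul_eq_zero hi.1 hb, zero_mul]

/-- For fixed `i` the products over all `j` sum to `1`, by the row sums. An identity may therefore
be checked after multiplying by each of them. -/
theorem AutRelations.eq_zero_of_pathProd_mul {q : V → V → B} (h : AutRelations Γ q) {x : B}
    (i : List V) (hx : ∀ j : List V, i.length = j.length → pathProd q i j * x = 0) : x = 0 := by
  induction i with
  | nil => simpa [pathProd, factors] using hx [] rfl
  | cons a i ih =>
    refine ih fun j hj => ?_
    rw [← one_mul (pathProd q i j * x), ← h.row_sum a, Finset.sum_mul]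
    refine Finset.sum_eq_zero fun b _ => ?_
    rw [← mul_assoc, ← pathProd_cons]
    exact hx (b :: j) (by simp [hj])

theorem GkRelations.pathProd_reverse {q : V → V → B} (h : GkRelations Γ k q) {i j : List V}
    (hij : i.length = j.length) (hi : i.IsChain Γ.Adj) (hj : j.IsChain Γ.Adj)
    (hk : i.length ≤ k + 1) : pathProd q i j = (factors q i j).reverse.prod := by
  by_cases hn : i = []
  · subst hn; simp [pathProd, factors]
  · exact h.path_reverse ⟨i, hn, hi⟩ ⟨j, fun hj' => hn (by simpa [hj'] using hij), hj⟩ hij hk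

/-- Reverse the whole product, then reverse its tail back: the head has moved from the left end to
the right end. -/
theorem GkRelations.commute_head {q : V → V → B} (h : GkRelations Γ k q) {a b : V} {i j : List V}
    (hij : i.length = j.length) (hi : (a :: i).IsChain Γ.Adj) (hj : (b :: j).IsChain Γ.Adj)
    (hk : (a :: i).length ≤ k + 1) : Commute (q a b) (pathProd q i j) := by
  have h1 := h.pathProd_reverse (by simp [hij]) hi hj hk
  rw [factors_cons, List.reverse_cons, List.prod_append, List.prod_singleton,
    ← h.pathProd_reverse hij hi.tail hj.tail (by simp at hk; omega), pathProd_cons] at h1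
  exact h1

end Relations

/-! ### The comultiplication and isolation of its terms -/

section Comp

variable {B : Type*} [Ring B]

/-- The matrix product of two matrices of generators; for commuting entries this is the
comultiplication. -/
def comp (a b : V → V → B) (i l : V) : B := ∑ j, a i j * b j l

variable {a b : V → V → B}

theorem comp_swap (hab : ∀ i j m n, Commute (a i j) (b m n)) (i j : V) :
    comp a b i j = comp (fun x y => b y x) (fun x y => a y x) j i :=
  Finset.sum_congr rfl fun m _ => (hab i m m j).eq

variable [StarRing B]

theorem mul_comp (ha : AutRelations Γ a) (i j l : V) : a i j * comp a b i l = a i j * b j l := by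
  rw [comp, Finset.mul_sum, Finset.sum_eq_single j, ← mul_assoc, ha.idem]
  · intro m _ hm
    rw [← mul_assoc, ha.row_orth i j m hm.symm, zero_mul]
  · simp

theorem comp_mul (ha : AutRelations Γ a) (hab : ∀ i j m n, Commute (a i j) (b m n)) (i j l : V) :
    comp a b i l * a i j = b j l * a i j := by
  rw [comp, Finset.sum_mul, Finset.sum_eq_single j, (hab i j j l).eq, mul_assoc, ha.idem]
  · intro m _ hm
    rw [(hab i m m l).eq, mul_assoc, ha.row_orth i m j hm, mul_zero]
  · simp

theorem comp_mul_comp (ha : AutRelations Γ a) (hab : ∀ i j m n, Commute (a i j) (b m n))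
    (i j l : V) : comp a b i j * comp a b i l = ∑ m, a i m * (b m j * b m l) := by
  conv_lhs => enter [1]; rw [comp]
  rw [Finset.sum_mul]
  refine Finset.sum_congr rfl fun m _ => ?_
  rw [(hab i m m j).eq, mul_assoc, mul_comp ha, ← mul_assoc, ← (hab i m m j).eq, mul_assoc]

/-- By `GkRelations.commute_head` the head `a x y` can be moved to the right end of its product,
where `mul_comp` selects the summand `y`; it is then moved back and the tail is handled by
induction. -/
theorem pathProd_mul_pathProd_comp (ha : GkRelations Γ k a)
    (hab : ∀ i j m n, Commute (a i j) (b m n)) {i j l : List V} (hij : i.length = j.length)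
    (hil : i.length = l.length) (hi : i.IsChain Γ.Adj) (hj : j.IsChain Γ.Adj)
    (hk : i.length ≤ k + 1) :
    pathProd a i j * pathProd (comp a b) i l = pathProd a i j * pathProd b j l := by
  induction i generalizing j l with
  | nil => cases j <;> cases l <;> simp_all [pathProd, factors]
  | cons x i ih =>
    cases j with
    | nil => simp at hij
    | cons y j =>
      cases l with
      | nil => simp at hil
      | cons z l =>
        have hij' : i.length = j.length := by simpa using hij
        have hc := ha.commute_head hij' hi hj hk
        have ih := ih hij' (by simpa using hil) hi.tail hj.tail (by simp at hk; omega)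
        have hb : Commute (pathProd a i j) (b y z) :=
          (commute_pathProd (fun m n => (hab m n y z).symm) i j).symm
        simp only [pathProd_cons]
        calc a x y * pathProd a i j * (comp a b x z * pathProd (comp a b) i l)
            = pathProd a i j * (a x y * comp a b x z) * pathProd (comp a b) i l := by
              rw [hc.eq]; simp only [mul_assoc]
          _ = a x y * (pathProd a i j * b y z) * pathProd (comp a b) i l := by
              rw [mul_comp ha.toAutRelations, ← mul_assoc, ← hc.eq]; simp only [mul_assoc]
          _ = a x y * b y z * (pathProd a i j * pathProd (comp a b) i l) := by
              rw [hb.eq]; simp only [mul_assoc]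
          _ = a x y * (b y z * pathProd a i j) * pathProd b j l := by
              rw [ih]; simp only [mul_assoc]
          _ = a x y * pathProd a i j * (b y z * pathProd b j l) := by
              rw [← hb.eq]; simp only [mul_assoc]

theorem pathProd_comp_mul_pathProd (ha : GkRelations Γ k a)
    (hab : ∀ i j m n, Commute (a i j) (b m n)) {i j l : List V} (hij : i.length = j.length)
    (hil : i.length = l.length) (hi : i.IsChain Γ.Adj) (hj : j.IsChain Γ.Adj)
    (hk : i.length ≤ k + 1) :
    pathProd (comp a b) i l * pathProd a i j = pathProd b j l * pathProd a i j := by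
  induction i generalizing j l with
  | nil => cases j <;> cases l <;> simp_all [pathProd, factors]
  | cons x i ih =>
    cases j with
    | nil => simp at hij
    | cons y j =>
      cases l with
      | nil => simp at hil
      | cons z l =>
        have hij' : i.length = j.length := by simpa using hij
        have hc := ha.commute_head hij' hi hj hk
        have ih := ih hij' (by simpa using hil) hi.tail hj.tail (by simp at hk; omega)
        have hb : Commute (a x y) (pathProd b j l) := commute_pathProd (hab x y) j l
        simp only [pathProd_cons]
        calc comp a b x z * pathProd (comp a b) i l * (a x y * pathProd a i j)
            = comp a b x z * (pathProd (comp a b) i l * pathProd a i j) * a x y := by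
              rw [hc.eq]; simp only [mul_assoc]
          _ = comp a b x z * pathProd b j l * (a x y * pathProd a i j) := by
              rw [ih, hc.eq]; simp only [mul_assoc]
          _ = comp a b x z * (a x y * pathProd b j l) * pathProd a i j := by
              rw [hb.eq]; simp only [mul_assoc]
          _ = b y z * (a x y * pathProd b j l) * pathProd a i j := by
              rw [← mul_assoc, comp_mul ha.toAutRelations hab]; simp only [mul_assoc]
          _ = b y z * pathProd b j l * (a x y * pathProd a i j) := by
              rw [hb.eq]; simp only [mul_assoc]

/-- Needed, together with `pathProd_mul_pathProd_comp`, to pass the reversal relations from `b` to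
`comp a b`. -/
theorem pathProd_mul_reverse_comp (ha : GkRelations Γ k a)
    (hab : ∀ i j m n, Commute (a i j) (b m n)) {i j l : List V} (hij : i.length = j.length)
    (hil : i.length = l.length) (hi : i.IsChain Γ.Adj) (hj : j.IsChain Γ.Adj)
    (hk : i.length ≤ k + 1) :
    pathProd a i j * (factors (comp a b) i l).reverse.prod =
      pathProd a i j * (factors b j l).reverse.prod := by
  induction i generalizing j l with
  | nil => cases j <;> cases l <;> simp_all [pathProd, factors]
  | cons x i ih =>
    cases j with
    | nil => simp at hij
    | cons y j =>
      cases l with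
      | nil => simp at hil
      | cons z l =>
        have hij' : i.length = j.length := by simpa using hij
        have hc := ha.commute_head hij' hi hj hk
        have ih := ih hij' (by simpa using hil) hi.tail hj.tail (by simp at hk; omega)
        have hb : Commute (a x y) (factors b j l).reverse.prod := commute_reverse_prod (hab x y) j l
        simp only [pathProd_cons, factors_cons, List.reverse_cons, List.prod_append,
          List.prod_singleton]
        calc a x y * pathProd a i j * ((factors (comp a b) i l).reverse.prod * comp a b x z)
            = a x y * (pathProd a i j * (factors (comp a b) i l).reverse.prod) * comp a b x z := by
              simp only [mul_assoc]
          _ = pathProd a i j * (a x y * (factors b j l).reverse.prod) * comp a b x z := by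
              rw [ih, ← mul_assoc, hc.eq]; simp only [mul_assoc]
          _ = pathProd a i j * (factors b j l).reverse.prod * (a x y * b y z) := by
              rw [hb.eq, ← mul_comp ha.toAutRelations]; simp only [mul_assoc]
          _ = pathProd a i j * (a x y * (factors b j l).reverse.prod) * b y z := by
              rw [hb.eq]; simp only [mul_assoc]
          _ = a x y * pathProd a i j * ((factors b j l).reverse.prod * b y z) := by
              rw [hc.eq]; simp only [mul_assoc]

/-- The relations are stable under the comultiplication. -/
theorem GkRelations.comp (ha : GkRelations Γ k a) (hb : GkRelations Γ k b)
    (hab : ∀ i j m n, Commute (a i j) (b m n)) : GkRelations Γ k (comp a b) where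
  selfAdjoint i j := by
    rw [QuantumPath.comp, star_sum]
    refine Finset.sum_congr rfl fun m _ => ?_
    rw [star_mul, ha.selfAdjoint, hb.selfAdjoint, (hab i m m j).eq]
  row_sum i := by
    simp only [QuantumPath.comp]
    rw [Finset.sum_comm]
    simp only [← Finset.mul_sum, hb.row_sum, mul_one, ha.row_sum]
  col_sum i := by
    simp only [QuantumPath.comp]
    rw [Finset.sum_comm]
    simp only [← Finset.sum_mul, ha.col_sum, one_mul, hb.col_sum]
  idem i j := by
    rw [comp_mul_comp ha.toAutRelations hab]
    simp only [hb.idem, QuantumPath.comp]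
  row_orth i j l hjl := by
    rw [comp_mul_comp ha.toAutRelations hab]
    simp [hb.row_orth _ j l hjl]
  col_orth i j l hjl := by
    -- Transposition exchanges the roles of `a` and `b` and reduces columns to rows.
    rw [comp_swap hab, comp_swap hab,
      comp_mul_comp hb.transpose.toAutRelations fun i j m n => (hab n m j i).symm]
    simp [ha.col_orth _ j l hjl]
  comm_vertexMatrix := by
    have : Matrix.of (QuantumPath.comp a b) = Matrix.of a * Matrix.of b := by
      ext i j; simp [Matrix.mul_apply, QuantumPath.comp]
    rw [this, Matrix.mul_assoc, hb.comm_vertexMatrix, ← Matrix.mul_assoc, ha.comm_vertexMatrix,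
      Matrix.mul_assoc]
  path_reverse i l hil hk := by
    -- After multiplication by the `a`-product over `(i, j)`, the claim becomes the reversal
    -- relation for `b` over `(j, l)`. This is available only for paths `j`; for other `j` the
    -- multiplier vanishes.
    refine sub_eq_zero.1 (ha.eq_zero_of_pathProd_mul i.verts fun j hij => ?_)
    by_cases hj : j.IsChain Γ.Adj
    · rw [mul_sub, sub_eq_zero, ← pathProd,
        pathProd_mul_pathProd_comp ha hab hij hil i.chain hj hk,
        pathProd_mul_reverse_comp ha hab hij hil i.chain hj hk,
        hb.pathProd_reverse (hij.symm.trans hil) hj l.chain (hij ▸ hk)]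
    · rw [ha.pathProd_eq_zero hij i.chain hj, zero_mul]

/-- For paths with at most `2k + 2` vertices, one term of the comultiplication of a product along
a path can be isolated by multiplying with the two halves of that term. -/
theorem pathProd_mul_pathProd_eq_zero (ha : GkRelations Γ k a)
    (hab : ∀ i j m n, Commute (a i j) (b m n)) {i j l : List V} (hij : i.length = j.length)
    (hil : i.length = l.length) (hi : i.IsChain Γ.Adj) (hj : j.IsChain Γ.Adj)
    (hk : i.length ≤ 2 * k + 2) (h0 : pathProd (comp a b) i l = 0) :
    pathProd a i j * pathProd b j l = 0 := by
  -- The cut after `k + 1` vertices leaves at most `k + 1` on each side, within reach of the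
  -- reversal relations.
  have split (q : V → V → B) {s t : List V} (hst : s.length = t.length) :
      pathProd q s t = pathProd q (s.take (k + 1)) (t.take (k + 1)) *
        pathProd q (s.drop (k + 1)) (t.drop (k + 1)) := by
    rw [← pathProd_append _ _ _ (by simp [hst]), List.take_append_drop, List.take_append_drop]
  have h1 := pathProd_mul_pathProd_comp ha hab (i := i.take (k + 1)) (j := j.take (k + 1))
    (l := l.take (k + 1)) (by simp [hij]) (by simp [hil]) (hi.take _) (hj.take _) (by simp)
  have h2 := pathProd_comp_mul_pathProd ha hab (i := i.drop (k + 1)) (j := j.drop (k + 1))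
    (l := l.drop (k + 1)) (by simp [hij]) (by simp [hil]) (hi.drop _) (hj.drop _)
    (by rw [List.length_drop]; omega)
  have hb (s t u v : List V) : Commute (pathProd a s t) (pathProd b u v) :=
    commute_pathProd (fun m n =>
      (commute_pathProd (fun x y => (hab x y m n).symm) s t).symm) u v
  rw [split _ hil] at h0
  rw [split a hij, split b (hij.symm.trans hil)]
  generalize i.take (k + 1) = i₁, i.drop (k + 1) = i₂, j.take (k + 1) = j₁, j.drop (k + 1) = j₂,
    l.take (k + 1) = l₁, l.drop (k + 1) = l₂ at *
  calc pathProd a i₁ j₁ * pathProd a i₂ j₂ * (pathProd b j₁ l₁ * pathProd b j₂ l₂)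
      = pathProd a i₁ j₁ * (pathProd a i₂ j₂ * pathProd b j₁ l₁) * pathProd b j₂ l₂ := by
        simp only [mul_assoc]
    _ = pathProd a i₁ j₁ * pathProd b j₁ l₁ * (pathProd a i₂ j₂ * pathProd b j₂ l₂) := by
        rw [(hb i₂ j₂ j₁ l₁).eq]; simp only [mul_assoc]
    _ = pathProd a i₁ j₁ * (pathProd (QuantumPath.comp a b) i₁ l₁ *
          pathProd (QuantumPath.comp a b) i₂ l₂) * pathProd a i₂ j₂ := by
        rw [← h1, (hb i₂ j₂ j₂ l₂).eq, ← h2]; simp only [mul_assoc]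
    _ = 0 := by rw [h0, mul_zero, zero_mul]

end Comp

/-! ### Operators on Hilbert space tensor products -/

section Operators

open UniformSpace

/-- The extension of operators on an inner product space to its completion. -/
noncomputable def completionHom (E : Type*) [NormedAddCommGroup E] [InnerProductSpace ℂ E] :
    (E →L[ℂ] E) →+* (Completion E →L[ℂ] Completion E) where
  toFun T := T.completion
  map_one' := by
    ext x
    induction x using Completion.induction_on with
    | hp => exact isClosed_eq (by fun_prop) (by fun_prop)
    | ih x => simp
  map_mul' S T := by
    ext x
    induction x using Completion.induction_on with
    | hp => exact isClosed_eq (by fun_prop) (by fun_prop)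
    | ih x => simp
  map_zero' := by
    ext x
    induction x using Completion.induction_on with
    | hp => exact isClosed_eq (by fun_prop) (by fun_prop)
    | ih x => simp
  map_add' S T := by
    ext x
    induction x using Completion.induction_on with
    | hp => exact isClosed_eq (by fun_prop) (by fun_prop)
    | ih x => simp [Completion.coe_add]

theorem completionHom_coe {E : Type*} [NormedAddCommGroup E] [InnerProductSpace ℂ E]
    (T : E →L[ℂ] E) (x : E) : completionHom E T (x : Completion E) = (T x : E) :=
  T.completion_apply_coe x

/-- `E` need not be complete, so the adjoint relation is assumed as an identity of inner products on
`E` and extended by density. -/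
theorem star_completionHom {E : Type*} [NormedAddCommGroup E] [InnerProductSpace ℂ E]
    {S T : E →L[ℂ] E} (h : ∀ x y, inner ℂ (S x) y = inner ℂ x (T y)) :
    completionHom E S = star (completionHom E T) := by
  rw [ContinuousLinearMap.star_eq_adjoint, ContinuousLinearMap.eq_adjoint_iff]
  intro x y
  induction x, y using Completion.induction_on₂ with
  | hp => exact isClosed_eq (by fun_prop) (by fun_prop)
  | ih x y => simp [completionHom_coe, h]

variable (H K : Type*) [NormedAddCommGroup H] [InnerProductSpace ℂ H] [NormedAddCommGroup K]
  [InnerProductSpace ℂ K]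

/-- `T ↦ T ⊗ 1` on the Hilbert space tensor product. -/
noncomputable def leftHom : (H →L[ℂ] H) →+* (Completion (H ⊗[ℂ] K) →L[ℂ] Completion (H ⊗[ℂ] K)) :=
  (completionHom (H ⊗[ℂ] K)).comp
    { toFun := fun T => T.rTensor K
      map_one' := by simp
      map_mul' := fun _ _ => ContinuousLinearMap.rTensor_mul ..
      map_zero' := by simp
      map_add' := fun _ _ => by simp }

/-- `S ↦ 1 ⊗ S` on the Hilbert space tensor product. -/
noncomputable def rightHom : (K →L[ℂ] K) →+* (Completion (H ⊗[ℂ] K) →L[ℂ] Completion (H ⊗[ℂ] K)) :=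
  (completionHom (H ⊗[ℂ] K)).comp
    { toFun := fun T => T.lTensor H
      map_one' := by simp
      map_mul' := fun _ _ => ContinuousLinearMap.lTensor_mul ..
      map_zero' := by simp
      map_add' := fun _ _ => by simp }

variable {H K}

theorem leftHom_coe (T : H →L[ℂ] H) (x : H ⊗[ℂ] K) :
    leftHom H K T (x : Completion (H ⊗[ℂ] K)) = (T.rTensor K x : H ⊗[ℂ] K) :=
  completionHom_coe ..

theorem rightHom_coe (T : K →L[ℂ] K) (x : H ⊗[ℂ] K) :
    rightHom H K T (x : Completion (H ⊗[ℂ] K)) = (T.lTensor H x : H ⊗[ℂ] K) :=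
  completionHom_coe ..

theorem commute_leftHom_rightHom (S : H →L[ℂ] H) (T : K →L[ℂ] K) :
    Commute (leftHom H K S) (rightHom H K T) := by
  refine Commute.map (f := completionHom (H ⊗[ℂ] K)) ?_
  change S.rTensor K ∘L T.lTensor H = T.lTensor H ∘L S.rTensor K
  rw [ContinuousLinearMap.rTensor_comp_lTensor, ContinuousLinearMap.lTensor_comp_rTensor]

/-- If `S x ≠ 0` and `T y ≠ 0`, then `x ⊗ y` is sent to `S x ⊗ T y`, of norm `‖S x‖ * ‖T y‖ ≠ 0`. -/
theorem leftHom_mul_rightHom_ne_zero {S : H →L[ℂ] H} {T : K →L[ℂ] K} (hS : S ≠ 0) (hT : T ≠ 0) :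
    leftHom H K S * rightHom H K T ≠ 0 := by
  obtain ⟨x, hx⟩ := ContinuousLinearMap.exists_ne_zero hS
  obtain ⟨y, hy⟩ := ContinuousLinearMap.exists_ne_zero hT
  intro h
  have h1 := congrArg norm (DFunLike.congr_fun h ((x ⊗ₜ[ℂ] y : H ⊗[ℂ] K) : Completion (H ⊗[ℂ] K)))
  rw [mul_apply_eq_comp, rightHom_coe, leftHom_coe] at h1
  simp [hx, hy] at h1

theorem inner_tensor_eq {f g : H ⊗[ℂ] K →ₗ[ℂ] H ⊗[ℂ] K}
    (h : ∀ x y x' y', inner ℂ (f (x ⊗ₜ y)) (x' ⊗ₜ[ℂ] y') = inner ℂ (x ⊗ₜ[ℂ] y) (g (x' ⊗ₜ y')))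
    (s t : H ⊗[ℂ] K) : inner ℂ (f s) t = inner ℂ s (g t) := by
  induction s with
  | zero => simp
  | add s s' hs hs' => rw [map_add, inner_add_left, inner_add_left, hs, hs']
  | tmul x y =>
    induction t with
    | zero => simp
    | add t t' ht ht' => rw [map_add, inner_add_right, inner_add_right, ht, ht']
    | tmul x' y' => exact h x y x' y'

theorem leftHom_star [CompleteSpace H] (T : H →L[ℂ] H) :
    leftHom H K (star T) = star (leftHom H K T) :=
  star_completionHom fun s t => inner_tensor_eq
    (f := ((star T).rTensor K).toLinearMap) (g := (T.rTensor K).toLinearMap)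
    (fun x y x' y' => by
      simp [ContinuousLinearMap.star_eq_adjoint, ContinuousLinearMap.adjoint_inner_left]) s t

theorem rightHom_star [CompleteSpace K] (T : K →L[ℂ] K) :
    rightHom H K (star T) = star (rightHom H K T) :=
  star_completionHom fun s t => inner_tensor_eq
    (f := ((star T).lTensor H).toLinearMap) (g := (T.lTensor H).toLinearMap)
    (fun x y x' y' => by
      simp [ContinuousLinearMap.star_eq_adjoint, ContinuousLinearMap.adjoint_inner_left]) s t

end Operators

/-! ### Counit, transpose and tensor product of representations -/

section Representations

open UniformSpace

/-- The representations separate the elements of the universal algebra by construction, so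
non-vanishing can be tested and exhibited in a single one. -/
theorem pathProd_q_ne_zero_iff (i j : List V) :
    pathProd (q Γ k) i j ≠ 0 ↔ ∃ π : HilbertRep Γ k, pathProd π.op i j ≠ 0 := by
  have h (π : HilbertRep Γ k) : evalRep π (pathProd (q Γ k) i j) = pathProd π.op i j := by
    rw [pathProd, map_list_prod, evalRep_factors, pathProd]
  constructor
  · intro hne
    by_contra! hz
    exact hne (evalRep_ext fun π => by rw [h, hz, map_zero])
  · rintro ⟨π, hπ⟩ hz
    exact hπ (by rw [← h, hz, map_zero])

variable (Γ k) in
/-- The counit: the one-dimensional representation by the identity matrix. -/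
noncomputable def HilbertRep.trivial [DecidableEq V] : HilbertRep Γ k where
  H := ℂ
  op i j := algebraMap ℂ (ℂ →L[ℂ] ℂ) ((1 : Matrix V V ℂ) i j)
  rel := (gkRelations_one ℂ).map (algebraMap ℂ (ℂ →L[ℂ] ℂ)) algebraMap_star_comm

theorem HilbertRep.pathProd_trivial [DecidableEq V] (i : List V) :
    pathProd (HilbertRep.trivial Γ k).op i i = 1 := by
  induction i with
  | nil => rfl
  | cons a i ih =>
    rw [pathProd_cons, ih, mul_one]
    change algebraMap ℂ (ℂ →L[ℂ] ℂ) ((1 : Matrix V V ℂ) a a) = 1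
    rw [Matrix.one_apply_eq, map_one]

/-- The representation by the transposed matrix. -/
def HilbertRep.transpose (π : HilbertRep Γ k) : HilbertRep Γ k where
  H := π.H
  op i j := π.op j i
  rel := π.rel.transpose

/-- The tensor product of two representations. -/
noncomputable def HilbertRep.tensor (π ρ : HilbertRep Γ k) : HilbertRep Γ k where
  H := Completion (π.H ⊗[ℂ] ρ.H)
  nontriv := by
    obtain ⟨x, hx⟩ := exists_ne (0 : π.H)
    obtain ⟨y, hy⟩ := exists_ne (0 : ρ.H)
    refine ⟨((x ⊗ₜ[ℂ] y : π.H ⊗[ℂ] ρ.H) : Completion (π.H ⊗[ℂ] ρ.H)), 0, fun h => ?_⟩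
    have := congrArg norm h
    simp [hx, hy] at this
  op := comp (fun i j => leftHom π.H ρ.H (π.op i j)) fun i j => rightHom π.H ρ.H (ρ.op i j)
  rel := (π.rel.map _ leftHom_star).comp (ρ.rel.map _ rightHom_star)
    fun _ _ _ _ => commute_leftHom_rightHom _ _

theorem HilbertRep.pathProd_tensor_ne_zero (π ρ : HilbertRep Γ k) {i j l : List V}
    (hij : i.length = j.length) (hil : i.length = l.length) (hi : i.IsChain Γ.Adj)
    (hj : j.IsChain Γ.Adj) (hk : i.length ≤ 2 * k + 2) (h1 : pathProd π.op i j ≠ 0)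
    (h2 : pathProd ρ.op j l ≠ 0) : pathProd (π.tensor ρ).op i l ≠ 0 := by
  intro h0
  have := pathProd_mul_pathProd_eq_zero (π.rel.map (leftHom π.H ρ.H) leftHom_star)
    (b := fun i j => rightHom π.H ρ.H (ρ.op i j))
    (fun _ _ _ _ => commute_leftHom_rightHom _ _) hij hil hi hj hk h0
  rw [map_pathProd (leftHom π.H ρ.H), map_pathProd (rightHom π.H ρ.H)] at this
  exact leftHom_mul_rightHom_ne_zero h1 h2 this

end Representations

end QuantumPath

open QuantumPath in
theorem mainTheorem4 {V : Type*} [Fintype V] (Γ : SimpleGraph V) (k : ℕ) :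
    Equivalence (fun i j : {p : QuantumPath.GraphPath Γ // p.length ≤ 2 * k + 1} =>
      QuantumPath.KEquiv Γ k i.1 j.1) := by
  classical
  refine ⟨fun i => ⟨rfl, ?_⟩, ?_, ?_⟩
  · rw [pathProd_q_ne_zero_iff]
    exact ⟨.trivial Γ k, by rw [HilbertRep.pathProd_trivial]; exact one_ne_zero⟩
  · rintro i j ⟨hij, h⟩
    obtain ⟨π, hπ⟩ := (pathProd_q_ne_zero_iff _ _).1 h
    refine ⟨hij.symm, (pathProd_q_ne_zero_iff _ _).2 ⟨π.transpose, ?_⟩⟩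
    -- Transposing exchanges the two paths but keeps the order of the factors, so the same operator
    -- product appears.
    change (factors (fun x y => π.op y x) _ _).prod ≠ 0
    rwa [factors_swap]
  · rintro i j l ⟨hij, h1⟩ ⟨hjl, h2⟩
    obtain ⟨π, hπ⟩ := (pathProd_q_ne_zero_iff _ _).1 h1
    obtain ⟨ρ, hρ⟩ := (pathProd_q_ne_zero_iff _ _).1 h2
    have hi := i.2
    refine ⟨hij.trans hjl, (pathProd_q_ne_zero_iff _ _).2 ⟨π.tensor ρ,
      π.pathProd_tensor_ne_zero ρ ?_ ?_ i.1.chain j.1.chain ?_ hπ hρ⟩⟩ <;>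
    simp only [GraphPath.length_verts] <;> omega
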